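/- Let $n\ge 2$ and let $X_1,\dots,X_n$ be independent random variables with the normal distribution $N(\mu,\sigma^2)$, $\sigma>0$. Let $T\in\mathbb R$ (the target) and $k>1$, and put $$\bar X=\frac1n\sum_{i=1}^nX_i,\qquad S_n^2=\frac1n\sum_{i=1}^n(X_i-\bar X)^2,\qquad S_{n-1}^2=\frac1{n-1}\sum_{i=1}^n(X_i-\bar X)^2,\qquad \delta=\frac{\sqrt n(\mu-T)}\sigma .$$ Let $\phi$ be the density of $N(0,1)$ and $f_K$ the density of the $\chi^2$ distribution with $n-1$ degrees of freedom. **Upper tolerance.** Let $U>T$, $B_u=\sqrt n(U-T)/\sigma$, $\hat A_u^*=\max\{\bar X-T,(T-\bar X)/k\}$, and $$\hat C_{pku,n}=\frac{U-T-\hat A_u^*}{3S_n},\qquad \hat C_{pku,n-1}=\frac{U-T-\hat A_u^*}{3S_{n-1}},\qquad f_{Y_u}(y)=\frac1{2\sqrt y}\bigl(\phi(\sqrt y-\delta)+k\,\phi(k\sqrt y+\delta)\bigr)\quad(y>0).$$ Then $\hat C_{pku,n}$ has the probability density $$f_{\hat C_{pku,n}}(x)=\begin{cases}-\int_1^\infty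 J_1(x,t)\,dt,&x<0,\\ \int_0^1J_1(x,t)\,dt,&x>0,\end{cases}\qquad J_1(x,t)=f_K\!\left(\Bigl(\tfrac{B_u(1-\sqrt t)}{3x}\Bigr)^2\right)f_{Y_u}(B_u^2t)\,\frac{2B_u^2}{x}\Bigl(\tfrac{B_u(1-\sqrt t)}{3x}\Bigr)^2,$$ which can also be written $$f_{\hat C_{pku,n}}(x)=\begin{cases}-\int_{B_u^2}^\infty J_1'(x,t)\,dt,&x<0,\\ \int_0^{B_u^2}J_1'(x,t)\,dt,&x>0,\end{cases}\qquad J_1'(x,t)=f_K\!\left(\Bigl(\tfrac{B_u-\sqrt t}{3x}\Bigr)^2\right)f_{Y_u}(t)\,\frac{2}{x}\Bigl(\tfrac{B_u-\sqrt t}{3x}\Bigr)^2 .$$ Moreover $\hat C_{pku,n-1}=\sqrt{(n-1)/n}\;\hat C_{pku,n}$, and $\hat C_{pku,n-1}$ has the probability density $$f_{\hat C_{pku,n-1}}(x)=\begin{cases}-\int_1^\infty L_1(x,t)\,dt,&x<0,\\ \int_0^1L_1(x,t)\,dt,&x>0,\end{cases}$$ $$L_1(x,t)=f_K\!\left(\tfrac{n-1}n\Bigl(\tfrac{B_u(1-\sqrt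 t)}{3x}\Bigr)^2\right)f_{Y_u}(B_u^2t)\,\frac{2B_u^2}{x}\,\frac{n-1}n\Bigl(\tfrac{B_u(1-\sqrt t)}{3x}\Bigr)^2 .$$ All these integrals converge absolutely. **Lower tolerance.** Let $L<T$, $B_l=\sqrt n(T-L)/\sigma$, $\hat A_l^*=\max\{(\bar X-T)/k,\,T-\bar X\}$, and $$\hat C_{pkl,n}=\frac{T-L-\hat A_l^*}{3S_n},\qquad \hat C_{pkl,n-1}=\frac{T-L-\hat A_l^*}{3S_{n-1}},\qquad f_{Y_l}(y)=\frac1{2\sqrt y}\bigl(k\,\phi(k\sqrt y-\delta)+\phi(\sqrt y+\delta)\bigr)\quad(y>0).$$ Then all the assertions above hold for $\hat C_{pkl,n}$ and $\hat C_{pkl,n-1}$ with $f_{Y_u}$ replaced by $f_{Y_l}$ and $B_u$ replaced by $B_l$. -/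

import Mathlib

open MeasureTheory ProbabilityTheory

noncomputable section

namespace Capability

/-- The sample mean `X̄` of `x 0, …, x (n-1)`. -/
def sampleMean {n : ℕ} (x : Fin n → ℝ) : ℝ := (∑ i, x i) / (n : ℝ)

/-- The sum of squared deviations `∑ (x i - X̄)²`. -/
def sumSqDev {n : ℕ} (x : Fin n → ℝ) : ℝ := ∑ i, (x i - sampleMean x) ^ 2

/-- `S_n²`, with divisor `n`. -/
def sampleVar {n : ℕ} (x : Fin n → ℝ) : ℝ := sumSqDev x / (n : ℝ)

/-- `S_{n-1}²`, with divisor `n - 1`. -/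
def sampleVar' {n : ℕ} (x : Fin n → ℝ) : ℝ := sumSqDev x / ((n : ℝ) - 1)

/-- `A_u^*`: the weighted shift of `m` from the target `T` for an upper tolerance; shifts away
from the tolerance count `k` times less. -/
def upperShift (T k m : ℝ) : ℝ := max (m - T) ((T - m) / k)

/-- `A_l^*`: the weighted shift of `m` from the target `T` for a lower tolerance. -/
def lowerShift (T k m : ℝ) : ℝ := max ((m - T) / k) (T - m)

/-- The general index `(D - u A) / (3 √(s2 + v A²))`, where `D` is the distance from the target to
the tolerance, `A` the weighted shift and `s2` the variance. -/
def capabilityIndex (D u v A s2 : ℝ) : ℝ := (D - u * A) / (3 * Real.sqrt (s2 + v * A ^ 2))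

/-- `Ĉ_{pu,n}(u,v)`. -/
def cpuHat {n : ℕ} (U T k u v : ℝ) (x : Fin n → ℝ) : ℝ :=
  capabilityIndex (U - T) u v (upperShift T k (sampleMean x)) (sampleVar x)

/-- `Ĉ_{pu,n-1}(u,v)`. -/
def cpuHat' {n : ℕ} (U T k u v : ℝ) (x : Fin n → ℝ) : ℝ :=
  capabilityIndex (U - T) u v (upperShift T k (sampleMean x)) (sampleVar' x)

/-- `Ĉ_{pl,n}(u,v)`. -/
def cplHat {n : ℕ} (L T k u v : ℝ) (x : Fin n → ℝ) : ℝ :=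
  capabilityIndex (T - L) u v (lowerShift T k (sampleMean x)) (sampleVar x)

/-- `Ĉ_{pl,n-1}(u,v)`. -/
def cplHat' {n : ℕ} (L T k u v : ℝ) (x : Fin n → ℝ) : ℝ :=
  capabilityIndex (T - L) u v (lowerShift T k (sampleMean x)) (sampleVar' x)

/-- `Ĉ_{pku,n} = Ĉ_{pu,n}(1,0)`. -/
def cpkuHat {n : ℕ} (U T k : ℝ) (x : Fin n → ℝ) : ℝ := cpuHat U T k 1 0 x

/-- `Ĉ_{pku,n-1} = Ĉ_{pu,n-1}(1,0)`. -/
def cpkuHat' {n : ℕ} (U T k : ℝ) (x : Fin n → ℝ) : ℝ := cpuHat' U T k 1 0 x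

/-- `Ĉ_{pkl,n} = Ĉ_{pl,n}(1,0)`. -/
def cpklHat {n : ℕ} (L T k : ℝ) (x : Fin n → ℝ) : ℝ := cplHat L T k 1 0 x

/-- `Ĉ_{pkl,n-1} = Ĉ_{pl,n-1}(1,0)`. -/
def cpklHat' {n : ℕ} (L T k : ℝ) (x : Fin n → ℝ) : ℝ := cplHat' L T k 1 0 x

/-- The standard normal density `φ`. -/
def stdNormalPDF (x : ℝ) : ℝ := gaussianPDFReal 0 1 x

/-- The chi-squared density with `ν` degrees of freedom. -/
def chiSqPDF (ν y : ℝ) : ℝ :=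
  if 0 < y then
    y ^ (ν / 2 - 1) * Real.exp (-(y / 2)) / ((2 : ℝ) ^ (ν / 2) * Real.Gamma (ν / 2))
  else 0

/-- `f_{Y_u}`. -/
def upperShiftPDF (k δ y : ℝ) : ℝ :=
  if 0 < y then
    1 / (2 * Real.sqrt y) *
      (stdNormalPDF (Real.sqrt y - δ) + k * stdNormalPDF (k * Real.sqrt y + δ))
  else 0

/-- `f_{Y_l}`. -/
def lowerShiftPDF (k δ y : ℝ) : ℝ :=
  if 0 < y then
    1 / (2 * Real.sqrt y) *
      (k * stdNormalPDF (k * Real.sqrt y - δ) + stdNormalPDF (Real.sqrt y + δ))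
  else 0

/-- The integrand `J₁(x,t)`, for given densities `fK`, `fY` and a given constant `B`. -/
def J₁ (fK fY : ℝ → ℝ) (B x t : ℝ) : ℝ :=
  fK ((B * (1 - Real.sqrt t) / (3 * x)) ^ 2) * fY (B ^ 2 * t) * (2 * B ^ 2 / x) *
    (B * (1 - Real.sqrt t) / (3 * x)) ^ 2

/-- The integrand `J₁'(x,t)` obtained from `J₁` by the substitution `t ↦ B² t`. -/
def J₁' (fK fY : ℝ → ℝ) (B x t : ℝ) : ℝ :=
  fK (((B - Real.sqrt t) / (3 * x)) ^ 2) * fY t * (2 / x) * ((B - Real.sqrt t) / (3 * x)) ^ 2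

/-- The integrand `L₁(x,t)` for the estimators with divisor `n - 1`. -/
def L₁ (n : ℕ) (fK fY : ℝ → ℝ) (B x t : ℝ) : ℝ :=
  fK (((n : ℝ) - 1) / n * (B * (1 - Real.sqrt t) / (3 * x)) ^ 2) * fY (B ^ 2 * t) *
    (2 * B ^ 2 / x) * (((n : ℝ) - 1) / n) * (B * (1 - Real.sqrt t) / (3 * x)) ^ 2

/-- The function equal to `-∫_b^∞ J(x,t) dt` for `x < 0` and to `∫_0^b J(x,t) dt` for `x > 0`
(and to `0` at the single point `x = 0`). -/
def splitIntegral (J : ℝ → ℝ → ℝ) (b x : ℝ) : ℝ :=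
  if x < 0 then -∫ t in Set.Ioi b, J x t
  else if 0 < x then ∫ t in Set.Ioo 0 b, J x t
  else 0

/-- `f` is a probability density, with respect to Lebesgue measure, of the real random
variable `Z` under `P`. -/
structure IsDensity {Ω : Type*} [MeasurableSpace Ω] (Z : Ω → ℝ) (P : Measure Ω)
    (f : ℝ → ℝ) : Prop where
  aemeasurable : AEMeasurable Z P
  measurable : Measurable f
  nonneg : ∀ x, 0 ≤ f x
  map_eq : P.map Z = volume.withDensity (fun x => ENNReal.ofReal (f x))

/-- The integrals `∫_b^∞ J(x,t) dt` (`x < 0`) and `∫_0^b J(x,t) dt` (`x > 0`) converge, and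
`splitIntegral J b` is a density of `Z`. -/
structure HasSplitDensity {Ω : Type*} [MeasurableSpace Ω] (Z : Ω → ℝ) (P : Measure Ω)
    (J : ℝ → ℝ → ℝ) (b : ℝ) : Prop where
  integrable_neg : ∀ x < 0, IntegrableOn (J x) (Set.Ioi b)
  integrable_pos : ∀ x > 0, IntegrableOn (J x) (Set.Ioo 0 b)
  isDensity : IsDensity Z P (splitIntegral J b)

end Capability

end

open Capability

/-! Put `V = √n (X̄ - T) / σ` and `K = ∑ (X i - X̄)² / σ²`. Each of the four indices equals `√c (B -
max (V / a) (-V / b)) / (3 √K)`, with `c = 1` or `c = (n - 1) / n` according to the divisor, and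
`(a, b) = (1, k)` or `(k, 1)` according to the tolerance. One computation therefore covers all cases
(`hasSplitDensity_ratioIntegrand`).

Its input is that `V ∼ N(δ, 1)` and `K ∼ χ²` with `n - 1` degrees of freedom are independent. In an
orthonormal basis whose first vector is constant, the standardized mean is the first coordinate and
the sum of squared deviations is the sum of squares of the others; the Gaussian law is invariant
under this rotation (`map_mean_sumSqDev_pi_gaussianReal`).

Let `Y` be the square of the maximum; its density adds the contributions of `V = a √y` and `V = -b
√y` (`map_sq_max_gaussianReal`). For fixed `Y = t`, the index `x` has the sign of `B - √t` and `K =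
c ((B - √t) / (3 x))²`, so a change of variables gives the conditional density (`lintegral_ratio`).
Tonelli averages it over `t` (`map_ratio_eq_withDensity`), and the sign condition turns into `t >
B²` for `x < 0` and `t < B²` for `x > 0`. This is `J₁'`; `J₁` and `L₁` arise by rescaling `t` by
`B²`. -/

noncomputable section

namespace Capability

open Set

/-! ### Density of a ratio of independent variables -/

/-- Change of variables `y = c (w / (3 x))²` on the half-line where `x` has the sign of `w`. -/
theorem lintegral_Ioi_eq_lintegral_ratio {c w : ℝ} (hc : 0 < c) (hw : w ≠ 0)
    (F : ℝ → ENNReal) :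
    ∫⁻ y in Ioi 0, F y = ∫⁻ x in {x | 0 < w * x},
      ENNReal.ofReal (2 / |x| * (c * (w / (3 * x)) ^ 2)) * F (c * (w / (3 * x)) ^ 2) := by
  have hx0 {x : ℝ} (hx : x ∈ {x | 0 < w * x}) : x ≠ 0 := by
    rintro rfl; simp at hx
  have hS : MeasurableSet {x | 0 < w * x} := measurableSet_lt (by fun_prop) (by fun_prop)
  have himage : (fun x => c * (w / (3 * x)) ^ 2) '' {x | 0 < w * x} = Ioi 0 := by
    ext y
    constructor
    · rintro ⟨x, hx, rfl⟩
      have := hx0 hx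
      exact mem_Ioi.2 (by positivity)
    · intro hy
      have hy : 0 < y := hy
      refine ⟨w * √c / (3 * √y), ?_, ?_⟩
      · have : 0 < w * w := mul_self_pos.2 hw
        have h : w * (w * √c / (3 * √y)) = w * w * (√c / (3 * √y)) := by ring
        rw [mem_ofPred_eq, h]; positivity
      · have h : w / (3 * (w * √c / (3 * √y))) = √y / √c := by
          field_simp
        simp only [h, div_pow, Real.sq_sqrt hy.le, Real.sq_sqrt hc.le]
        field_simp
  have hinj : InjOn (fun x => c * (w / (3 * x)) ^ 2) {x | 0 < w * x} := by
    intro x hx y hy hxy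
    have hx' := hx0 hx
    have hy' := hx0 hy
    simp only at hxy
    field_simp at hxy
    have hx1 : 0 < w * x := hx
    have hy1 : 0 < w * y := hy
    have : (w * x) ^ 2 = (w * y) ^ 2 := by rw [mul_pow, mul_pow, hxy]
    rw [sq_eq_sq₀ hx1.le hy1.le] at this
    exact mul_left_cancel₀ hw this
  have hderiv : ∀ x ∈ {x | 0 < w * x}, HasDerivWithinAt (fun x => c * (w / (3 * x)) ^ 2)
      (-(2 / x) * (c * (w / (3 * x)) ^ 2)) {x | 0 < w * x} x := by
    intro x hx
    have hx' := hx0 hx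
    have h1 : HasDerivAt (fun x => c * (w / (3 * x)) ^ 2) _ x :=
      (((hasDerivAt_const x w).div ((hasDerivAt_id x).const_mul 3) (by simpa using hx')).pow
        2).const_mul c
    refine (h1.congr_deriv ?_).hasDerivWithinAt
    simp
    field_simp
  rw [← himage, lintegral_image_eq_lintegral_abs_deriv_mul hS hderiv hinj]
  refine setLIntegral_congr_fun hS fun x _ => ?_
  rw [abs_mul, abs_neg, abs_div, abs_two, abs_of_nonneg (a := c * _) (by positivity)]

/-- The integrand of the density of `√c (B - √Y) / (3 √K)`, for independent nonnegative `Y` and `K`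
with densities `fY` and `fK`. -/
def ratioIntegrand (c : ℝ) (fK fY : ℝ → ℝ) (B x t : ℝ) : ℝ :=
  fK (c * ((B - √t) / (3 * x)) ^ 2) * fY t * (2 / x) * (c * ((B - √t) / (3 * x)) ^ 2)

theorem measurable_ratioIntegrand {c : ℝ} {fK fY : ℝ → ℝ} (hK : Measurable fK)
    (hY : Measurable fY) (B : ℝ) :
    Measurable (Function.uncurry (ratioIntegrand c fK fY B)) := by
  unfold ratioIntegrand Function.uncurry
  fun_prop

/-- The Jacobian supplies exactly the factor that turns `fK` into the bounded function `y * fK y`;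
what remains is the integrable `fY`. -/
theorem integrable_ratioIntegrand {c M : ℝ} {fK fY : ℝ → ℝ} (hc : 0 ≤ c) (hK : Measurable fK)
    (hbdd : ∀ y, 0 ≤ y → |fK y * y| ≤ M) (hY : Integrable fY) (B x : ℝ) :
    Integrable (ratioIntegrand c fK fY B x) := by
  have h : ratioIntegrand c fK fY B x = fun t =>
      (2 / x * (fK (c * ((B - √t) / (3 * x)) ^ 2) * (c * ((B - √t) / (3 * x)) ^ 2))) * fY t := by
    ext t; rw [ratioIntegrand]; ring
  rw [h]
  refine hY.bdd_mul (c := |2 / x| * M) (by fun_prop) (Filter.Eventually.of_forall fun t => ?_)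
  rw [Real.norm_eq_abs, abs_mul]
  gcongr
  exact hbdd _ (by positivity)

theorem measurable_splitIntegral {J : ℝ → ℝ → ℝ} (hJ : Measurable (Function.uncurry J)) (b : ℝ) :
    Measurable (splitIntegral J b) := by
  unfold splitIntegral
  have h (s : Set ℝ) : Measurable fun x => ∫ t in s, J x t :=
    (StronglyMeasurable.integral_prod_right hJ.stronglyMeasurable).measurable
  refine Measurable.ite measurableSet_Iio (h _).neg (Measurable.ite measurableSet_Ioi (h _) ?_)
  exact measurable_const

theorem splitIntegral_ratioIntegrand_nonneg {c : ℝ} {fK fY : ℝ → ℝ} (hc : 0 ≤ c)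
    (hK0 : ∀ y, 0 ≤ fK y) (hY0 : ∀ y, 0 ≤ fY y) (B b x : ℝ) :
    0 ≤ splitIntegral (ratioIntegrand c fK fY B) b x := by
  unfold splitIntegral
  split_ifs with h1 h2
  · rw [← integral_neg]
    refine integral_nonneg fun t => ?_
    have : 0 ≤ -(2 / x) := by rw [← div_neg]; exact div_nonneg zero_le_two (by linarith)
    have h := mul_nonneg (mul_nonneg (hK0 (c * ((B - √t) / (3 * x)) ^ 2)) (hY0 t))
      (mul_nonneg this (show 0 ≤ c * ((B - √t) / (3 * x)) ^ 2 by positivity))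
    simp only [Pi.zero_apply, ratioIntegrand]
    linarith
  · refine integral_nonneg fun t => ?_
    have := hK0 (c * ((B - √t) / (3 * x)) ^ 2)
    have := hY0 t
    simp only [Pi.zero_apply, ratioIntegrand]
    positivity
  · exact le_rfl

/-- Both branches integrate over the `t` for which `B - √t` has the sign of `x`, and `2 / |x|`
absorbs the minus sign of the negative branch. A single formula for both signs is what Tonelli
needs. -/
theorem ofReal_splitIntegral_ratioIntegrand {c B x : ℝ} {fK fY : ℝ → ℝ} (hc : 0 ≤ c) (hB : 0 < B)
    (hK0 : ∀ y, 0 ≤ fK y) (hY0 : ∀ y, 0 ≤ fY y) (hY1 : ∀ y ≤ 0, fY y = 0)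
    (hint : Integrable (ratioIntegrand c fK fY B x)) (hx : x ≠ 0) :
    ENNReal.ofReal (splitIntegral (ratioIntegrand c fK fY B) (B ^ 2) x) =
      ∫⁻ t, ENNReal.ofReal (fY t) * {x | 0 < (B - √t) * x}.indicator
        (fun x => ENNReal.ofReal (2 / |x| * (c * ((B - √t) / (3 * x)) ^ 2)) *
          ENNReal.ofReal (fK (c * ((B - √t) / (3 * x)) ^ 2))) x := by
  have hlt (t : ℝ) : √t < B ↔ t < B ^ 2 := Real.sqrt_lt' hB
  have hgt (t : ℝ) : B < √t ↔ B ^ 2 < t := Real.lt_sqrt hB.le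
  rcases hx.lt_or_gt with hx | hx
  · rw [splitIntegral, if_pos hx, ← integral_neg, ofReal_integral_eq_lintegral_ofReal
      (f := fun t => -ratioIntegrand c fK fY B x t) hint.neg.integrableOn, ← lintegral_indicator measurableSet_Ioi]
    · refine lintegral_congr fun t => ?_
      have hiff : x ∈ {x | 0 < (B - √t) * x} ↔ t ∈ Ioi (B ^ 2) := by
        simp [← hgt, mul_pos_iff, hx, hx.not_gt]
      by_cases ht : t ∈ Ioi (B ^ 2)
      · rw [indicator_of_mem ht, indicator_of_mem (hiff.2 ht), ← ENNReal.ofReal_mul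
          (by positivity), ← ENNReal.ofReal_mul (hY0 t), abs_of_neg hx, ratioIntegrand, div_neg]
        congr 1
        ring
      · rw [indicator_of_notMem ht, indicator_of_notMem (mt hiff.1 ht), mul_zero]
    · refine Filter.Eventually.of_forall fun t => ?_
      have : 0 ≤ -(2 / x) := by rw [← div_neg]; exact div_nonneg zero_le_two (by linarith)
      have h := mul_nonneg (mul_nonneg (hK0 (c * ((B - √t) / (3 * x)) ^ 2)) (hY0 t))
        (mul_nonneg this (show 0 ≤ c * ((B - √t) / (3 * x)) ^ 2 by positivity))
      simp only [Pi.zero_apply, ratioIntegrand]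
      linarith
  · rw [splitIntegral, if_neg hx.not_gt, if_pos hx, ofReal_integral_eq_lintegral_ofReal
      hint.integrableOn, ← lintegral_indicator measurableSet_Ioo]
    · refine lintegral_congr fun t => ?_
      -- For `t ≤ 0` one has `√t = 0`, so the sign condition holds although `t` is outside the
      -- interval; only the vanishing of `fY` removes these `t`.
      rcases le_or_gt t 0 with ht0 | ht0
      · rw [indicator_of_notMem (fun h => h.1.not_ge ht0), hY1 t ht0]
        simp
      have hiff : x ∈ {x | 0 < (B - √t) * x} ↔ t ∈ Ioo 0 (B ^ 2) := by
        rw [mem_ofPred_eq, mem_Ioo, ← hlt, mul_pos_iff_of_pos_right hx]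
        simp [ht0]
      by_cases ht : t ∈ Ioo 0 (B ^ 2)
      · rw [indicator_of_mem ht, indicator_of_mem (hiff.2 ht), ← ENNReal.ofReal_mul
          (by positivity), ← ENNReal.ofReal_mul (hY0 t), abs_of_pos hx, ratioIntegrand]
        congr 1
        ring
      · rw [indicator_of_notMem ht, indicator_of_notMem (mt hiff.1 ht), mul_zero]
    · refine Filter.Eventually.of_forall fun t => ?_
      have := hK0 (c * ((B - √t) / (3 * x)) ^ 2)
      have := hY0 t
      simp only [Pi.zero_apply, ratioIntegrand]
      positivity

/-- The conditional law of the ratio once its numerator `w = B - √t` is fixed. -/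
theorem lintegral_ratio {c w : ℝ} {fK : ℝ → ℝ} (hc : 0 < c) (hw : w ≠ 0)
    (hK1 : ∀ y ≤ 0, fK y = 0) (g : ℝ → ENNReal) :
    ∫⁻ q, ENNReal.ofReal (fK q) * g (√c * (w / (3 * √q))) =
      ∫⁻ x, {x | 0 < w * x}.indicator
        (fun x => ENNReal.ofReal (2 / |x| * (c * (w / (3 * x)) ^ 2)) *
          ENNReal.ofReal (fK (c * (w / (3 * x)) ^ 2))) x * g x := by
  have hS : MeasurableSet {x | 0 < w * x} := measurableSet_lt (by fun_prop) (by fun_prop)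
  have h1 : ∫⁻ q, ENNReal.ofReal (fK q) * g (√c * (w / (3 * √q))) =
      ∫⁻ q in Ioi 0, ENNReal.ofReal (fK q) * g (√c * (w / (3 * √q))) := by
    rw [← lintegral_indicator measurableSet_Ioi]
    refine lintegral_congr fun q => ?_
    by_cases hq : q ∈ Ioi 0
    · rw [indicator_of_mem hq]
    · rw [indicator_of_notMem hq, hK1 q (not_lt.1 hq)]; simp
  simp_rw [← indicator_mul_left]
  rw [h1, lintegral_Ioi_eq_lintegral_ratio hc hw, lintegral_indicator hS]
  refine setLIntegral_congr_fun hS fun x hx => ?_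
  have hx : 0 < w * x := hx
  have hx0 : x ≠ 0 := by rintro rfl; simp at hx
  have hwx : 0 < w / (3 * x) := by
    have : w / (3 * x) = w * x / (3 * x ^ 2) := by field_simp
    rw [this]; positivity
  have hback : √c * (w / (3 * √(c * (w / (3 * x)) ^ 2))) = x := by
    rw [Real.sqrt_mul hc.le, Real.sqrt_sq hwx.le]
    have := Real.sqrt_pos.2 hc
    field_simp
  rw [hback, mul_assoc]

theorem map_ratio_eq_withDensity {c B : ℝ} {fK fY : ℝ → ℝ} (hc : 0 < c) (hB : 0 < B)
    (hK : Measurable fK) (hK0 : ∀ y, 0 ≤ fK y) (hK1 : ∀ y ≤ 0, fK y = 0)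
    (hY : Measurable fY) (hY0 : ∀ y, 0 ≤ fY y) (hY1 : ∀ y ≤ 0, fY y = 0)
    (hint : ∀ x, Integrable (ratioIntegrand c fK fY B x)) :
    ((volume.withDensity fun y => ENNReal.ofReal (fY y)).prod
        (volume.withDensity fun q => ENNReal.ofReal (fK q))).map
        (fun p => √c * ((B - √p.1) / (3 * √p.2))) =
      volume.withDensity fun x =>
        ENNReal.ofReal (splitIntegral (ratioIntegrand c fK fY B) (B ^ 2) x) := by
  refine Measure.ext_of_lintegral _ fun g hg => ?_
  rw [lintegral_map hg (by fun_prop), lintegral_prod _ (by fun_prop),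
    lintegral_withDensity_eq_lintegral_mul _ (by fun_prop) (by fun_prop),
    lintegral_withDensity_eq_lintegral_mul _ (measurable_splitIntegral
      (measurable_ratioIntegrand hK hY B) _).ennreal_ofReal hg]
  have hker : Measurable (Function.uncurry fun t x : ℝ => {x | 0 < (B - √t) * x}.indicator
      (fun x => ENNReal.ofReal (2 / |x| * (c * ((B - √t) / (3 * x)) ^ 2)) *
        ENNReal.ofReal (fK (c * ((B - √t) / (3 * x)) ^ 2))) x) := by
    refine Measurable.indicator (s := {p : ℝ × ℝ | 0 < (B - √p.1) * p.2}) ?_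
      (measurableSet_lt (by fun_prop) (by fun_prop))
    fun_prop
  -- At `t = B²` the numerator vanishes and the ratio is constant, so the change of variables
  -- degenerates; this is a null set of `t`.
  have hne : ∀ᵐ t : ℝ, t ≠ B ^ 2 := by
    simp [ae_iff]
  have hne0 : ∀ᵐ x : ℝ, x ≠ 0 := by
    simp [ae_iff]
  calc _ = ∫⁻ t, ∫⁻ x, ENNReal.ofReal (fY t) * ({x | 0 < (B - √t) * x}.indicator
        (fun x => ENNReal.ofReal (2 / |x| * (c * ((B - √t) / (3 * x)) ^ 2)) *
          ENNReal.ofReal (fK (c * ((B - √t) / (3 * x)) ^ 2))) x * g x) := by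
        refine lintegral_congr_ae (hne.mono fun t ht => ?_)
        have hw : B - √t ≠ 0 := by
          intro h
          apply ht
          have h' : √t = B := by linarith
          have ht0 : 0 < t := Real.sqrt_pos.1 (h' ▸ hB)
          rw [← h', Real.sq_sqrt ht0.le]
        simp only [Pi.mul_apply]
        rw [lintegral_withDensity_eq_lintegral_mul _ (by fun_prop) (by fun_prop),
          lintegral_const_mul' _ _ ENNReal.ofReal_ne_top, ← lintegral_ratio hc hw hK1]
        rfl
    _ = ∫⁻ x, ∫⁻ t, ENNReal.ofReal (fY t) * ({x | 0 < (B - √t) * x}.indicator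
        (fun x => ENNReal.ofReal (2 / |x| * (c * ((B - √t) / (3 * x)) ^ 2)) *
          ENNReal.ofReal (fK (c * ((B - √t) / (3 * x)) ^ 2))) x * g x) := by
        refine lintegral_lintegral_swap (Measurable.aemeasurable ?_)
        exact Measurable.mul (by fun_prop) (hker.mul (by fun_prop))
    _ = _ := by
        refine lintegral_congr_ae (hne0.mono fun x hx => ?_)
        have hm : Measurable fun t => ENNReal.ofReal (fY t) * {x | 0 < (B - √t) * x}.indicator
            (fun x => ENNReal.ofReal (2 / |x| * (c * ((B - √t) / (3 * x)) ^ 2)) *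
              ENNReal.ofReal (fK (c * ((B - √t) / (3 * x)) ^ 2))) x :=
          hY.ennreal_ofReal.mul (hker.comp (measurable_id.prodMk measurable_const))
        rw [Pi.mul_apply, ofReal_splitIntegral_ratioIntegrand hc.le hB hK0 hY0 hY1 (hint x) hx,
          ← lintegral_mul_const _ hm]
        exact lintegral_congr fun t => (mul_assoc _ _ _).symm

/-! ### Law of the squared weighted shift -/

/-- The density of `max (V / a) (-V / b) ^ 2` for `V` with law `N(δ, 1)`. -/
def shiftPDF (a b δ y : ℝ) : ℝ :=
  if 0 < y then
    1 / (2 * √y) * (a * stdNormalPDF (a * √y - δ) + b * stdNormalPDF (b * √y + δ))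
  else 0

@[fun_prop]
theorem measurable_stdNormalPDF : Measurable stdNormalPDF := measurable_gaussianPDFReal 0 1

theorem stdNormalPDF_nonneg (x : ℝ) : 0 ≤ stdNormalPDF x := gaussianPDFReal_nonneg 0 1 x

theorem stdNormalPDF_neg (x : ℝ) : stdNormalPDF (-x) = stdNormalPDF x := by
  simp [stdNormalPDF, gaussianPDFReal]

theorem measurable_shiftPDF (a b δ : ℝ) : Measurable (shiftPDF a b δ) :=
  Measurable.ite measurableSet_Ioi (by fun_prop) measurable_const

theorem shiftPDF_nonneg {a b : ℝ} (ha : 0 ≤ a) (hb : 0 ≤ b) (δ y : ℝ) : 0 ≤ shiftPDF a b δ y := by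
  unfold shiftPDF
  split_ifs
  · have := stdNormalPDF_nonneg (a * √y - δ)
    have := stdNormalPDF_nonneg (b * √y + δ)
    positivity
  · exact le_rfl

/-- Change of variables `v = a √y` on a half-line. -/
theorem setLIntegral_eq_lintegral_sqrt {a : ℝ} (ha : a ≠ 0) (F : ℝ → ENNReal) :
    ∫⁻ v in {v | 0 < a * v}, F v =
      ∫⁻ y in Ioi 0, ENNReal.ofReal (|a| / (2 * √y)) * F (a * √y) := by
  have himage : (fun y => a * √y) '' Ioi 0 = {v | 0 < a * v} := by
    ext v
    constructor
    · rintro ⟨y, hy, rfl⟩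
      have hy : 0 < y := hy
      have h : a * (a * √y) = a ^ 2 * √y := by ring
      simp only [mem_ofPred_eq, h]
      positivity
    · intro hv
      have hv : 0 < a * v := hv
      have hva : 0 < v / a := by
        have : v / a = a * v / a ^ 2 := by field_simp
        rw [this]; positivity
      refine ⟨(v / a) ^ 2, mem_Ioi.2 (by positivity), ?_⟩
      simp only [Real.sqrt_sq hva.le]
      field_simp
  have hinj : InjOn (fun y => a * √y) (Ioi 0) := by
    intro x hx y hy hxy
    exact (Real.sqrt_inj (le_of_lt hx) (le_of_lt hy)).1 (mul_left_cancel₀ ha hxy)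
  have hderiv : ∀ y ∈ Ioi (0 : ℝ), HasDerivWithinAt (fun y => a * √y) (a * (1 / (2 * √y)))
      (Ioi 0) y := fun y hy =>
    ((Real.hasDerivAt_sqrt (ne_of_gt hy)).const_mul a).hasDerivWithinAt
  rw [← himage, lintegral_image_eq_lintegral_abs_deriv_mul measurableSet_Ioi hderiv hinj]
  refine setLIntegral_congr_fun measurableSet_Ioi fun y _ => ?_
  rw [abs_mul, abs_of_nonneg (a := 1 / (2 * √y)) (by positivity), mul_one_div]

/-- The maximum is `v / a` for `v > 0` and `-v / b` for `v < 0`, so each half-line is parametrized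
by `√y` and contributes one summand; symmetry of the normal density rewrites the second. -/
theorem map_sq_max_gaussianReal {a b : ℝ} (ha : 0 < a) (hb : 0 < b) (δ : ℝ) :
    (gaussianReal 0 1).map (fun z => (max ((z + δ) / a) (-(z + δ) / b)) ^ 2) =
      volume.withDensity fun y => ENNReal.ofReal (shiftPDF a b δ y) := by
  refine Measure.ext_of_lintegral _ fun g hg => ?_
  rw [lintegral_map hg (by fun_prop), gaussianReal_of_var_ne_zero 0 one_ne_zero,
    lintegral_withDensity_eq_lintegral_mul _ (by fun_prop) (by fun_prop),
    lintegral_withDensity_eq_lintegral_mul _ (measurable_shiftPDF a b δ).ennreal_ofReal hg]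
  have hF : ∀ z, (gaussianPDF 0 1 * fun z => g ((max ((z + δ) / a) (-(z + δ) / b)) ^ 2)) z =
      (fun v => ENNReal.ofReal (stdNormalPDF (v - δ)) * g ((max (v / a) (-v / b)) ^ 2))
        (z + δ) := by
    intro z; simp [gaussianPDF, stdNormalPDF]
  have hpos : ∫⁻ v in Ioi 0, ENNReal.ofReal (stdNormalPDF (v - δ)) *
      g ((max (v / a) (-v / b)) ^ 2) =
      ∫⁻ y in Ioi 0, ENNReal.ofReal (a / (2 * √y) * stdNormalPDF (a * √y - δ)) * g y := by
    have h : Ioi 0 = {v | 0 < a * v} := by ext v; simp [ha]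
    nth_rw 1 [h]
    rw [setLIntegral_eq_lintegral_sqrt ha.ne', abs_of_pos ha]
    refine setLIntegral_congr_fun measurableSet_Ioi fun y hy => ?_
    have hy : 0 < y := hy
    have hm : max (a * √y / a) (-(a * √y) / b) = √y := by
      rw [mul_div_cancel_left₀ _ ha.ne', max_eq_left]
      exact (div_nonpos_of_nonpos_of_nonneg (by simp; positivity) hb.le).trans (Real.sqrt_nonneg y)
    rw [hm, Real.sq_sqrt hy.le, ← mul_assoc, ← ENNReal.ofReal_mul (by positivity)]
  have hneg : ∫⁻ v in Iio 0, ENNReal.ofReal (stdNormalPDF (v - δ)) *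
      g ((max (v / a) (-v / b)) ^ 2) =
      ∫⁻ y in Ioi 0, ENNReal.ofReal (b / (2 * √y) * stdNormalPDF (b * √y + δ)) * g y := by
    have h : Iio 0 = {v | 0 < (-b) * v} := by ext v; simp [mul_neg_iff, hb, hb.not_gt]
    rw [h, setLIntegral_eq_lintegral_sqrt (neg_ne_zero.2 hb.ne'), abs_neg, abs_of_pos hb]
    refine setLIntegral_congr_fun measurableSet_Ioi fun y hy => ?_
    have hy : 0 < y := hy
    have hm : max (-b * √y / a) (-(-b * √y) / b) = √y := by
      rw [neg_mul, neg_neg, mul_div_cancel_left₀ _ hb.ne', max_eq_right]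
      exact (div_nonpos_of_nonpos_of_nonneg (by simp; positivity) ha.le).trans (Real.sqrt_nonneg y)
    rw [hm, Real.sq_sqrt hy.le, ← mul_assoc, ← ENNReal.ofReal_mul (by positivity),
      show -b * √y - δ = -(b * √y + δ) by ring, stdNormalPDF_neg]
  rw [lintegral_congr hF, lintegral_add_right_eq_self
    (fun v => ENNReal.ofReal (stdNormalPDF (v - δ)) * g ((max (v / a) (-v / b)) ^ 2)) δ,
    ← lintegral_add_compl _ measurableSet_Ioi, compl_Ioi, setLIntegral_congr Iio_ae_eq_Iic.symm,
    hpos, hneg, ← lintegral_add_left (by fun_prop), ← lintegral_indicator measurableSet_Ioi]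
  refine lintegral_congr fun y => ?_
  simp only [Pi.mul_apply, shiftPDF]
  by_cases hy : 0 < y
  · have h1 := stdNormalPDF_nonneg (a * √y - δ)
    have h2 := stdNormalPDF_nonneg (b * √y + δ)
    rw [indicator_of_mem (mem_Ioi.2 hy), if_pos hy, ← add_mul,
      ← ENNReal.ofReal_add (by positivity) (by positivity)]
    congr 2
    ring
  · rw [indicator_of_notMem (by simpa using hy), if_neg hy]
    simp

theorem integrable_shiftPDF {a b : ℝ} (ha : 0 < a) (hb : 0 < b) (δ : ℝ) :
    Integrable (shiftPDF a b δ) := by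
  refine ⟨(measurable_shiftPDF a b δ).aestronglyMeasurable, ?_⟩
  rw [hasFiniteIntegral_iff_ofReal (Filter.Eventually.of_forall (shiftPDF_nonneg ha.le hb.le δ))]
  -- The integral is the total mass of a pushforward of a probability measure.
  have h := congrArg (fun ν : Measure ℝ => ν univ) (map_sq_max_gaussianReal ha hb δ)
  simp only [withDensity_apply _ MeasurableSet.univ, Measure.restrict_univ] at h
  rw [← h]
  exact measure_lt_top _ _

/-! ### The chi-squared density -/

theorem measurable_chiSqPDF (ν : ℝ) : Measurable (chiSqPDF ν) :=
  Measurable.ite measurableSet_Ioi (by fun_prop) measurable_const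

theorem chiSqPDF_nonneg {ν : ℝ} (hν : 0 < ν) (y : ℝ) : 0 ≤ chiSqPDF ν y := by
  unfold chiSqPDF
  have := Real.Gamma_pos_of_pos (half_pos hν)
  split_ifs <;> positivity

theorem chiSqPDF_of_nonpos (ν : ℝ) {y : ℝ} (hy : y ≤ 0) : chiSqPDF ν y = 0 := if_neg hy.not_gt

theorem exists_chiSqPDF_mul_le {ν : ℝ} (hν : 0 < ν) :
    ∃ M, ∀ y, 0 ≤ y → |chiSqPDF ν y * y| ≤ M := by
  have hG := Real.Gamma_pos_of_pos (half_pos hν)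
  refine ⟨ν ^ (ν / 2) / ((2 : ℝ) ^ (ν / 2) * Real.Gamma (ν / 2)), fun y hy => ?_⟩
  rw [abs_of_nonneg (mul_nonneg (chiSqPDF_nonneg hν y) hy), chiSqPDF]
  split_ifs with hy0
  · have h1 : y ^ (ν / 2) ≤ ν ^ (ν / 2) * Real.exp (y / 2) := by
      -- The scale `ν` is chosen so that raising to the power `ν / 2` produces exactly `exp (y /
      -- 2)`, which cancels the exponential in the density.
      have h : y ≤ ν * Real.exp (y / ν) := by
        have := Real.add_one_le_exp (y / ν)
        have h2 : y = ν * (y / ν) := by field_simp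
        calc y = ν * (y / ν) := h2
          _ ≤ _ := by gcongr; linarith
      calc y ^ (ν / 2) ≤ (ν * Real.exp (y / ν)) ^ (ν / 2) := by gcongr
        _ = _ := by
          rw [Real.mul_rpow hν.le (Real.exp_pos _).le, ← Real.exp_mul]
          congr 2
          field_simp
    have h2 : y ^ (ν / 2 - 1) * y = y ^ (ν / 2) := by
      rw [Real.rpow_sub_one hy0.ne']; field_simp
    rw [div_mul_eq_mul_div]
    gcongr
    calc _ = y ^ (ν / 2) * Real.exp (-(y / 2)) := by rw [← h2]; ring
      _ ≤ ν ^ (ν / 2) * Real.exp (y / 2) * Real.exp (-(y / 2)) := by gcongr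
      _ = _ := by rw [mul_assoc, ← Real.exp_add]; simp
  · rw [zero_mul]; positivity

theorem gammaMeasure_eq_withDensity_chiSqPDF (ν : ℝ) :
    gammaMeasure (ν / 2) (1 / 2) = volume.withDensity fun y => ENNReal.ofReal (chiSqPDF ν y) := by
  have hne0 : ∀ᵐ x : ℝ, x ≠ 0 := by
    simp [ae_iff]
  refine withDensity_congr_ae (hne0.mono fun y hy => ?_)
  simp only [gammaPDF, gammaPDFReal, chiSqPDF]
  rcases hy.lt_or_gt with hy | hy
  · rw [if_neg hy.not_ge, if_neg hy.not_gt]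
  · rw [if_pos hy.le, if_pos hy, one_div, Real.inv_rpow zero_le_two]
    congr 1
    have : (2 : ℝ)⁻¹ * y = y / 2 := by ring
    rw [this]
    field_simp

end Capability
end

/-! ### Sums of squares of standard normals via moment generating functions -/

namespace ProbabilityTheory

/-- The moment generating function determines a probability measure on `ℝ` when it is finite in a
neighbourhood of `0`. -/
theorem ext_of_mgf_id_eq {μ ν : Measure ℝ} [IsProbabilityMeasure μ] [IsFiniteMeasure ν]
    (h : mgf id μ = mgf id ν) (h0 : 0 ∈ interior (integrableExpSet id μ)) : μ = ν := by
  apply Measure.ext_of_charFun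
  ext t
  rw [← complexMGF_id_mul_I, ← complexMGF_id_mul_I]
  -- The complex moment generating function is analytic on the vertical strip over the interior of
  -- the integrability set. That strip contains the imaginary axis, where the function is the
  -- characteristic function.
  exact eqOn_complexMGF_of_mgf h (by simpa using h0)

theorem integral_gammaMeasure {a r : ℝ} (ha : 0 < a) (hr : 0 < r) (f : ℝ → ℝ) :
    ∫ x, f x ∂gammaMeasure a r =
      ∫ x in Set.Ioi 0, r ^ a / Real.Gamma a * x ^ (a - 1) * Real.exp (-(r * x)) * f x := by
  rw [gammaMeasure, integral_withDensity_eq_integral_toReal_smul (by unfold gammaPDF; fun_prop)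
    (by simp [gammaPDF]), ← integral_Ici_eq_integral_Ioi, ← integral_indicator measurableSet_Ici]
  congr with x
  rw [gammaPDF, ENNReal.toReal_ofReal (gammaPDFReal_nonneg ha hr x), gammaPDFReal]
  by_cases hx : 0 ≤ x <;> simp [hx]

/-- The value `0` for `t ≥ r` is the default of a divergent integral: the integrand then dominates
`x ^ (a - 1)`. Recording it allows moment generating functions to be compared at every `t`. -/
theorem mgf_id_gammaMeasure {a r : ℝ} (ha : 0 < a) (hr : 0 < r) (t : ℝ) :
    mgf id (gammaMeasure a r) t = if t < r then (r / (r - t)) ^ a else 0 := by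
  have hG := Real.Gamma_pos_of_pos ha
  have key : mgf id (gammaMeasure a r) t = r ^ a / Real.Gamma a *
      ∫ x in Set.Ioi 0, x ^ (a - 1) * Real.exp (-((r - t) * x)) := by
    rw [mgf, integral_gammaMeasure ha hr, ← integral_const_mul]
    congr with x
    rw [mul_assoc, ← Real.exp_add, mul_assoc]
    simp only [id]
    ring_nf
  rw [key]
  split_ifs with h
  · have h' : 0 < r - t := sub_pos.2 h
    rw [Real.integral_rpow_mul_exp_neg_mul_Ioi ha h', Real.div_rpow hr.le h'.le,
      Real.div_rpow zero_le_one h'.le, Real.one_rpow]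
    field_simp
  · rw [integral_undef, mul_zero]
    intro hi
    refine not_integrableOn_Ioi_rpow (a - 1) (hi.mono' (by fun_prop) ?_)
    filter_upwards [ae_restrict_mem measurableSet_Ioi] with x hx
    have hx : 0 < x := hx
    rw [Real.norm_of_nonneg (by positivity)]
    refine le_mul_of_one_le_right (by positivity) (Real.one_le_exp ?_)
    nlinarith

theorem integral_exp_mul_sq_gaussianReal (t : ℝ) :
    ∫ x, Real.exp (t * x ^ 2) ∂gaussianReal 0 1 =
      if t < 1 / 2 then ((1 / 2) / (1 / 2 - t)) ^ (1 / 2 : ℝ) else 0 := by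
  rw [integral_gaussianReal_eq_integral_smul one_ne_zero]
  have : ∀ x : ℝ, gaussianPDFReal 0 1 x • Real.exp (t * x ^ 2) =
      (√(2 * Real.pi))⁻¹ * Real.exp (-(1 / 2 - t) * x ^ 2) := by
    intro x
    rw [gaussianPDFReal, smul_eq_mul, mul_assoc, ← Real.exp_add]
    simp only [NNReal.coe_one, mul_one, sub_zero]
    ring_nf
  simp_rw [this]
  rw [integral_const_mul, integral_gaussian]
  split_ifs with h
  · have h' : 0 < 1 / 2 - t := sub_pos.2 h
    rw [← Real.sqrt_inv, ← Real.sqrt_mul (by positivity), ← Real.sqrt_eq_rpow]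
    congr 1
    field_simp
  · rw [Real.sqrt_eq_zero_of_nonpos (x := _ / _), mul_zero]
    exact div_nonpos_of_nonneg_of_nonpos Real.pi_pos.le (by linarith)

/-- The sum of the squares of `m` independent standard normal variables has the chi-squared
distribution with `m` degrees of freedom. -/
theorem map_sum_sq_pi_gaussianReal {m : ℕ} (hm : 0 < m) :
    (Measure.pi fun _ : Fin m => gaussianReal 0 1).map (fun x => ∑ i, x i ^ 2) =
      gammaMeasure (m / 2) (1 / 2) := by
  have ha : 0 < (m : ℝ) / 2 := by positivity
  have hr : (0 : ℝ) < 1 / 2 := by norm_num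
  have := isProbabilityMeasure_gammaMeasure ha hr
  have hmeas : Measurable fun x : Fin m → ℝ => ∑ i, x i ^ 2 := by fun_prop
  have := Measure.isProbabilityMeasure_map (μ := Measure.pi fun _ : Fin m => gaussianReal 0 1)
    hmeas.aemeasurable
  refine (ext_of_mgf_id_eq ?_ ?_).symm
  · ext t
    rw [mgf_id_gammaMeasure ha hr, mgf_id_map hmeas.aemeasurable, mgf]
    simp_rw [Finset.mul_sum, Real.exp_sum]
    rw [integral_fintype_prod_eq_prod (fun _ x => Real.exp (t * x ^ 2))]
    simp_rw [integral_exp_mul_sq_gaussianReal]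
    rw [Finset.prod_const, Finset.card_univ, Fintype.card_fin]
    split_ifs with h
    · have h' : 0 < 1 / 2 - t := sub_pos.2 h
      rw [← Real.rpow_mul_natCast (by positivity)]
      ring_nf
    · rw [zero_pow hm.ne']
  · refine mem_interior.2 ⟨Set.Iio (1 / 2), fun t ht => ?_, isOpen_Iio, by norm_num⟩
    have ht : t < 1 / 2 := ht
    have h' : 0 < 1 / 2 - t := sub_pos.2 ht
    -- Since a divergent integral has value `0`, positivity of the moment generating function
    -- certifies integrability.
    rw [integrableExpSet, Set.mem_ofPred_eq, ← mgf_pos_iff, mgf_id_gammaMeasure ha hr, if_pos ht]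
    positivity

end ProbabilityTheory

/-! ### Independence of the sample mean and the sum of squared deviations -/

namespace Capability

theorem sumSqDev_eq {n : ℕ} (hn : n ≠ 0) (x : Fin n → ℝ) :
    sumSqDev x = ∑ i, x i ^ 2 - (√n * sampleMean x) ^ 2 := by
  have h : ∑ i, x i = n * sampleMean x := by
    rw [sampleMean]; field_simp
  rw [mul_pow, Real.sq_sqrt (Nat.cast_nonneg n)]
  simp only [sumSqDev, sub_sq, Finset.sum_add_distrib, Finset.sum_sub_distrib, ← Finset.sum_mul,
    ← Finset.mul_sum, h, Finset.sum_const, Finset.card_univ, Fintype.card_fin, nsmul_eq_mul]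
  ring

@[fun_prop]
theorem measurable_sampleMean {n : ℕ} : Measurable (sampleMean (n := n)) := by
  unfold sampleMean; fun_prop

@[fun_prop]
theorem measurable_sumSqDev {n : ℕ} : Measurable (sumSqDev (n := n)) := by
  unfold sumSqDev; fun_prop

theorem exists_orthonormalBasis_constant (m : ℕ) :
    ∃ b : OrthonormalBasis (Fin (m + 1)) ℝ (EuclideanSpace ℝ (Fin (m + 1))),
      b 0 = WithLp.toLp 2 fun _ => (√(m + 1 : ℕ))⁻¹ := by
  let v : Fin (m + 1) → EuclideanSpace ℝ (Fin (m + 1)) :=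
    fun _ => WithLp.toLp 2 fun _ => (√(m + 1 : ℕ))⁻¹
  -- Only the vector at index `0` is prescribed; the other values of `v` are irrelevant to the
  -- extension.
  have hv : Orthonormal ℝ (Set.domRestrict {0} v) := by
    rw [orthonormal_subsingleton_iff]
    intro i
    rw [← sq_eq_sq₀ (norm_nonneg _) zero_le_one]
    simp [v, EuclideanSpace.real_norm_sq_eq, Real.sq_sqrt (show (0 : ℝ) ≤ m + 1 by positivity)]
    field_simp
  obtain ⟨b, hb⟩ := hv.exists_orthonormalBasis_extension_of_card_eq (by simp)
  exact ⟨b, hb 0 rfl⟩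

/-- For a standard normal sample of size `m + 1`, the normalized sample mean and the sum of squared
deviations are independent, with a standard normal and a chi-squared distribution. -/
theorem map_mean_sumSqDev_pi_gaussianReal {m : ℕ} (hm : 0 < m) :
    (Measure.pi fun _ : Fin (m + 1) => gaussianReal 0 1).map
        (fun x => (√(m + 1 : ℕ) * sampleMean x, sumSqDev x)) =
      (gaussianReal 0 1).prod (gammaMeasure (m / 2) (1 / 2)) := by
  obtain ⟨b, hb⟩ := exists_orthonormalBasis_constant m
  have hn : (√(m + 1 : ℕ)) ≠ 0 := by positivity
  have hmean (y : Fin (m + 1) → ℝ) :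
      √(m + 1 : ℕ) * sampleMean (WithLp.ofLp (∑ i, y i • b i)) = y 0 := by
    have h1 : inner ℝ (b 0) (∑ i, y i • b i) = y 0 := by
      simp [inner_sum, inner_smul_right, b.inner_eq_ite]
    rw [← h1, hb, PiLp.inner_apply, sampleMean]
    simp only [RCLike.inner_apply, conj_trivial, ← Finset.sum_mul]
    have : ((m + 1 : ℕ) : ℝ) = √(m + 1 : ℕ) * √(m + 1 : ℕ) :=
      (Real.mul_self_sqrt (Nat.cast_nonneg _)).symm
    nth_rw 2 [this]
    field_simp
  -- By Parseval the sum of squares is unchanged by the rotation, and subtracting the squared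
  -- normalized mean deletes the coordinate `0`.
  have hsq (y : Fin (m + 1) → ℝ) :
      sumSqDev (WithLp.ofLp (∑ i, y i • b i)) = ∑ i : Fin m, y i.succ ^ 2 := by
    have h1 : ∑ j, (WithLp.ofLp (∑ i, y i • b i) j) ^ 2 = ∑ i, y i ^ 2 := by
      rw [← EuclideanSpace.real_norm_sq_eq, ← b.sum_sq_inner_right]
      simp [inner_sum, inner_smul_right, b.inner_eq_ite]
    rw [sumSqDev_eq m.succ_ne_zero, h1, hmean, Fin.sum_univ_succ]
    ring
  -- Rotation invariance: the standard Gaussian measure has the same description in every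
  -- orthonormal basis.
  have hpi : (Measure.pi fun _ : Fin (m + 1) => gaussianReal 0 1) =
      (Measure.pi fun _ : Fin (m + 1) => gaussianReal 0 1).map
        (fun y => WithLp.ofLp (∑ i, y i • b i)) := by
    have h := map_pi_eq_stdGaussian (ι := Fin (m + 1))
    rw [stdGaussian_eq_map_pi_orthonormalBasis b] at h
    have h2 := congrArg (Measure.map (WithLp.ofLp (p := 2))) h
    rw [Measure.map_map (by fun_prop) (by fun_prop), Measure.map_map (by fun_prop) (by fun_prop)]
      at h2
    simpa [Function.comp_def] using h2
  rw [hpi, Measure.map_map (by fun_prop) (by fun_prop)]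
  have hcomp : (fun x : Fin (m + 1) → ℝ => (√(m + 1 : ℕ) * sampleMean x, sumSqDev x)) ∘
      (fun y => WithLp.ofLp (∑ i, y i • b i)) =
      Prod.map id (fun z : Fin m → ℝ => ∑ i, z i ^ 2) ∘
        MeasurableEquiv.piFinSuccAbove (fun _ => ℝ) 0 := by
    ext y
    · exact hmean y
    · exact hsq y
  rw [hcomp, ← Measure.map_map (by fun_prop) (by fun_prop),
    (measurePreserving_piFinSuccAbove (fun _ => gaussianReal 0 1) 0).map_eq,
    ← Measure.map_prod_map _ _ measurable_id (by fun_prop), Measure.map_id,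
    map_sum_sq_pi_gaussianReal hm]

end Capability

/-! ### Densities of the capability indices -/

namespace Capability

theorem hasSplitDensity_ratioIntegrand {Ω : Type*} [MeasurableSpace Ω] {P : Measure Ω}
    {Z : Ω → ℝ} {W : Ω → ℝ × ℝ} {ν a b c B δ : ℝ} (hν : 0 < ν) (ha : 0 < a) (hb : 0 < b)
    (hc : 0 < c) (hB : 0 < B)
    (hW : HasLaw W ((gaussianReal 0 1).prod (gammaMeasure (ν / 2) (1 / 2))) P)
    (hZ : ∀ ω, Z ω = √c * ((B - max (((W ω).1 + δ) / a) (-((W ω).1 + δ) / b)) /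
      (3 * √(W ω).2))) :
    HasSplitDensity Z P (ratioIntegrand c (chiSqPDF ν) (shiftPDF a b δ) B) (B ^ 2) := by
  obtain ⟨M, hM⟩ := exists_chiSqPDF_mul_le hν
  have hK := measurable_chiSqPDF ν
  have hY := measurable_shiftPDF a b δ
  have hint (x : ℝ) := integrable_ratioIntegrand hc.le hK hM (integrable_shiftPDF ha hb δ) B x
  have := isProbabilityMeasure_gammaMeasure (half_pos hν) (by norm_num : (0 : ℝ) < 1 / 2)
  have hcomp : Z = (fun p : ℝ × ℝ => √c * ((B - √p.1) / (3 * √p.2))) ∘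
      Prod.map (fun z => (max ((z + δ) / a) (-(z + δ) / b)) ^ 2) id ∘ W := by
    ext ω
    -- Nonnegativity of the shift allows it to be recovered as `√Y` from its square.
    have h0 : 0 ≤ max (((W ω).1 + δ) / a) (-((W ω).1 + δ) / b) := by
      rcases le_total 0 ((W ω).1 + δ) with h | h
      · exact le_max_of_le_left (div_nonneg h ha.le)
      · exact le_max_of_le_right (div_nonneg (neg_nonneg.2 h) hb.le)
    simp only [hZ ω, Function.comp_apply, Prod.map_fst, Prod.map_snd, id, Real.sqrt_sq h0]
  have hm1 : Measurable fun p : ℝ × ℝ => √c * ((B - √p.1) / (3 * √p.2)) := by fun_prop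
  have hm2 : Measurable (Prod.map (fun z : ℝ => (max ((z + δ) / a) (-(z + δ) / b)) ^ 2)
      (id : ℝ → ℝ)) := Measurable.prodMap (by fun_prop) measurable_id
  refine ⟨fun x _ => (hint x).integrableOn, fun x _ => (hint x).integrableOn, ?_, ?_, ?_, ?_⟩
  · rw [hcomp]
    exact hm1.comp_aemeasurable (hm2.comp_aemeasurable hW.aemeasurable)
  · exact measurable_splitIntegral (measurable_ratioIntegrand hK hY B) _
  · exact splitIntegral_ratioIntegrand_nonneg hc.le (chiSqPDF_nonneg hν)
      (shiftPDF_nonneg ha.le hb.le δ) B _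
  · rw [← map_ratio_eq_withDensity hc hB hK (chiSqPDF_nonneg hν)
      (fun y => chiSqPDF_of_nonpos ν) hY (shiftPDF_nonneg ha.le hb.le δ)
      (fun y hy => if_neg hy.not_gt) hint, ← gammaMeasure_eq_withDensity_chiSqPDF,
      ← map_sq_max_gaussianReal ha hb, hcomp, ← AEMeasurable.map_map_of_aemeasurable
      hm1.aemeasurable (hm2.comp_aemeasurable hW.aemeasurable),
      ← AEMeasurable.map_map_of_aemeasurable hm2.aemeasurable hW.aemeasurable, hW.map_eq]
    nth_rw 2 [← Measure.map_id (μ := gammaMeasure (ν / 2) (1 / 2))]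
    rw [Measure.map_prod_map _ _ (by fun_prop) measurable_id]

theorem setIntegral_Ioo_comp_mul_left {r : ℝ} (hr : 0 < r) (f : ℝ → ℝ) :
    ∫ t in Set.Ioo 0 1, r * f (r * t) = ∫ t in Set.Ioo 0 r, f t := by
  rw [← integral_Ioc_eq_integral_Ioo, ← integral_Ioc_eq_integral_Ioo,
    ← intervalIntegral.integral_of_le zero_le_one, ← intervalIntegral.integral_of_le hr.le,
    intervalIntegral.integral_const_mul, intervalIntegral.mul_integral_comp_mul_left]
  simp

theorem setIntegral_Ioi_comp_mul_left {r : ℝ} (hr : 0 < r) (f : ℝ → ℝ) :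
    ∫ t in Set.Ioi 1, r * f (r * t) = ∫ t in Set.Ioi r, f t := by
  rw [integral_const_mul, integral_comp_mul_left_Ioi f 1 hr, smul_eq_mul, mul_one,
    mul_inv_cancel_left₀ hr.ne']

/-- Rescaling the variable of integration in a split density. -/
theorem HasSplitDensity.comp_mul_left {Ω : Type*} [MeasurableSpace Ω] {P : Measure Ω}
    {Z : Ω → ℝ} {J J' : ℝ → ℝ → ℝ} {r : ℝ} (hr : 0 < r) (h : HasSplitDensity Z P J r)
    (hJ : ∀ x t, J' x t = r * J x (r * t)) : HasSplitDensity Z P J' 1 := by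
  have hJ' (x : ℝ) : J' x = fun t => r * J x (r * t) := funext (hJ x)
  refine ⟨fun x hx => ?_, fun x hx => ?_, ?_⟩
  · rw [hJ']
    refine Integrable.const_mul ?_ r
    have := (integrableOn_Ioi_comp_mul_left_iff (J x) 1 hr).2
    rw [mul_one] at this
    exact this (h.integrable_neg x hx)
  · rw [hJ']
    refine Integrable.const_mul ?_ r
    have := h.integrable_pos x hx
    rw [← integrableOn_Ioc_iff_integrableOn_Ioo,
      ← intervalIntegrable_iff_integrableOn_Ioc_of_le hr.le] at this
    rw [← IntegrableOn, ← integrableOn_Ioc_iff_integrableOn_Ioo,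
      ← intervalIntegrable_iff_integrableOn_Ioc_of_le zero_le_one]
    simpa [hr.ne'] using this.comp_mul_left (c := r)
  · have hs : splitIntegral J' 1 = splitIntegral J r := by
      ext x
      simp only [splitIntegral, hJ', setIntegral_Ioo_comp_mul_left hr,
        setIntegral_Ioi_comp_mul_left hr]
    rw [hs]
    exact h.isDensity

theorem hasLaw_mean_sumSqDev_of_standardized {Ω : Type*} [MeasurableSpace Ω] {P : Measure Ω}
    [IsProbabilityMeasure P] {n : ℕ} (hn : 2 ≤ n) {μ σ : ℝ} (hσ : 0 < σ) {X : Fin n → Ω → ℝ}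
    (hindep : iIndepFun X P)
    (hlaw : ∀ i, HasLaw (X i) (gaussianReal μ (Real.toNNReal (σ ^ 2))) P) :
    HasLaw (fun ω => (√n * sampleMean (fun i => (X i ω - μ) / σ),
        sumSqDev (fun i => (X i ω - μ) / σ)))
      ((gaussianReal 0 1).prod (gammaMeasure (((n : ℝ) - 1) / 2) (1 / 2))) P := by
  obtain ⟨m, rfl⟩ : ∃ m, n = m + 1 := ⟨n - 1, by omega⟩
  have hstd (i : Fin (m + 1)) : HasLaw (fun ω => (X i ω - μ) / σ) (gaussianReal 0 1) P := by
    refine (show HasLaw (fun x : ℝ => (x - μ) / σ) (gaussianReal 0 1) _ from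
      ⟨by fun_prop, ?_⟩).fun_comp (hlaw i)
    rw [show (fun x : ℝ => (x - μ) / σ) = (· / σ) ∘ (· - μ) from rfl,
      ← Measure.map_map (by fun_prop) (by fun_prop), gaussianReal_map_sub_const,
      gaussianReal_map_div_const, sub_self, zero_div]
    congr 1
    ext
    simp [Real.coe_toNNReal _ (sq_nonneg σ), hσ.ne']
  have hind : iIndepFun (fun i ω => (X i ω - μ) / σ) P :=
    hindep.comp (fun _ x => (x - μ) / σ) (fun _ => by fun_prop)
  have hpi : HasLaw (fun ω i => (X i ω - μ) / σ)
      (Measure.pi fun _ : Fin (m + 1) => gaussianReal 0 1) P := by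
    refine ⟨aemeasurable_pi_lambda _ fun i => (hstd i).aemeasurable, ?_⟩
    rw [(iIndepFun_iff_map_fun_eq_pi_map fun i => (hstd i).aemeasurable).1 hind]
    simp_rw [(hstd _).map_eq]
  have h := map_mean_sumSqDev_pi_gaussianReal (m := m) (by omega)
  refine (show HasLaw (fun x : Fin (m + 1) → ℝ => (√(m + 1 : ℕ) * sampleMean x, sumSqDev x)) _ _
    from ⟨by fun_prop, ?_⟩).fun_comp hpi
  rw [h]
  push_cast
  rw [add_sub_cancel_right]

theorem sampleMean_eq_add_mul {n : ℕ} (hn : n ≠ 0) {μ σ : ℝ} (hσ : σ ≠ 0) (x : Fin n → ℝ) :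
    sampleMean x = μ + σ * sampleMean fun i => (x i - μ) / σ := by
  simp only [sampleMean, ← Finset.sum_div, Finset.sum_sub_distrib, Finset.sum_const,
    Finset.card_univ, Fintype.card_fin, nsmul_eq_mul]
  field_simp
  ring

theorem sumSqDev_eq_mul {n : ℕ} (hn : n ≠ 0) {μ σ : ℝ} (hσ : σ ≠ 0) (x : Fin n → ℝ) :
    sumSqDev x = σ ^ 2 * sumSqDev fun i => (x i - μ) / σ := by
  simp only [sumSqDev, sampleMean_eq_add_mul hn hσ (μ := μ) x, Finset.mul_sum]
  refine Finset.sum_congr rfl fun i _ => ?_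
  field_simp
  ring

/-- The index `(D - A) / (3 √(q / N))` in terms of standardized variables, with `A` the maximum of
`V / a` and `-V / b`. -/
theorem capabilityIndex_eq_ratio {n : ℕ} (hn : n ≠ 0) {N D σ a b v q : ℝ} (hσ : 0 < σ)
    (hN : 0 < N) :
    capabilityIndex D 1 0 (max (σ * v / √n / a) (-(σ * v / √n) / b)) (σ ^ 2 * q / N) =
      √(N / n) * ((√n * D / σ - max (v / a) (-v / b)) / (3 * √q)) := by
  have hn' : 0 < √(n : ℝ) := Real.sqrt_pos.2 (by positivity)
  have hN' : 0 < √N := Real.sqrt_pos.2 hN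
  have hmax : max (σ * v / √n / a) (-(σ * v / √n) / b) = σ / √n * max (v / a) (-v / b) := by
    rw [mul_max_of_nonneg _ _ (by positivity)]
    congr 1 <;> ring
  rw [capabilityIndex, hmax, zero_mul, add_zero, one_mul, mul_div_assoc, Real.sqrt_mul (sq_nonneg σ),
    Real.sqrt_sq hσ.le, Real.sqrt_div' q hN.le, Real.sqrt_div hN.le]
  -- When the deviations vanish both sides are divisions by zero, hence `0`, so the identity holds
  -- at every sample point and not just almost surely.
  rcases eq_or_ne (√q) 0 with h | h
  · simp [h]
  field_simp

theorem sqrt_mul_capabilityIndex {n : ℕ} (hn : 2 ≤ n) (D A : ℝ) (x : Fin n → ℝ) :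
    capabilityIndex D 1 0 A (sampleVar' x) =
      √(((n : ℝ) - 1) / n) * capabilityIndex D 1 0 A (sampleVar x) := by
  have hn' : (2 : ℝ) ≤ n := by exact_mod_cast hn
  have h0 : (0 : ℝ) < n := by linarith
  have h1 : (0 : ℝ) < n - 1 := by linarith
  have h2 := Real.sqrt_pos.2 h0
  have h3 := Real.sqrt_pos.2 h1
  simp only [capabilityIndex, sampleVar, sampleVar', zero_mul, add_zero, Real.sqrt_div' _ h0.le,
    Real.sqrt_div' _ h1.le]
  rcases eq_or_ne (√(sumSqDev x)) 0 with h | h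
  · simp [h]
  field_simp

theorem upperShiftPDF_eq (k δ : ℝ) : upperShiftPDF k δ = shiftPDF 1 k δ := by
  ext y; simp [upperShiftPDF, shiftPDF]

theorem lowerShiftPDF_eq (k δ : ℝ) : lowerShiftPDF k δ = shiftPDF k 1 δ := by
  ext y; simp [lowerShiftPDF, shiftPDF]

theorem J₁'_eq_ratioIntegrand (fK fY : ℝ → ℝ) (B : ℝ) :
    J₁' fK fY B = ratioIntegrand 1 fK fY B := by
  ext x t; simp [J₁', ratioIntegrand]

theorem sub_sqrt_sq_mul {B : ℝ} (hB : 0 ≤ B) (t : ℝ) : B - √(B ^ 2 * t) = B * (1 - √t) := by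
  rw [Real.sqrt_mul (sq_nonneg B), Real.sqrt_sq hB]; ring

theorem J₁_eq_ratioIntegrand (fK fY : ℝ → ℝ) {B : ℝ} (hB : 0 ≤ B) (x t : ℝ) :
    J₁ fK fY B x t = B ^ 2 * ratioIntegrand 1 fK fY B x (B ^ 2 * t) := by
  rw [J₁, ratioIntegrand, sub_sqrt_sq_mul hB, one_mul]; ring

theorem L₁_eq_ratioIntegrand (n : ℕ) (fK fY : ℝ → ℝ) {B : ℝ} (hB : 0 ≤ B) (x t : ℝ) :
    L₁ n fK fY B x t = B ^ 2 * ratioIntegrand (((n : ℝ) - 1) / n) fK fY B x (B ^ 2 * t) := by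
  rw [L₁, ratioIntegrand, sub_sqrt_sq_mul hB]; ring

/-- The densities of the index with shift `max ((X̄ - T) / a) ((T - X̄) / b)` and of its variant with
divisor `n - 1`. -/
theorem hasSplitDensity_capabilityIndex {Ω : Type*} [MeasurableSpace Ω] {P : Measure Ω}
    [IsProbabilityMeasure P] {n : ℕ} (hn : 2 ≤ n) {μ σ T a b D : ℝ} (hσ : 0 < σ) (ha : 0 < a)
    (hb : 0 < b) (hD : 0 < D) {X : Fin n → Ω → ℝ} (hindep : iIndepFun X P)
    (hlaw : ∀ i, HasLaw (X i) (gaussianReal μ (Real.toNNReal (σ ^ 2))) P) {Z : Ω → ℝ}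
    {N : ℝ} (hN : 0 < N)
    (hZ : ∀ ω, Z ω = capabilityIndex D 1 0
      (max ((sampleMean (fun i => X i ω) - T) / a) ((T - sampleMean (fun i => X i ω)) / b))
      (sumSqDev (fun i => X i ω) / N)) :
    HasSplitDensity Z P (ratioIntegrand (N / n) (chiSqPDF ((n : ℝ) - 1))
      (shiftPDF a b (√n * (μ - T) / σ)) (√n * D / σ)) ((√n * D / σ) ^ 2) := by
  have hn0 : n ≠ 0 := by omega
  have hn' : (2 : ℝ) ≤ n := by exact_mod_cast hn
  have hsn : 0 < √(n : ℝ) := Real.sqrt_pos.2 (by linarith)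
  refine hasSplitDensity_ratioIntegrand (by linarith) ha hb (by positivity) (by positivity)
    (hasLaw_mean_sumSqDev_of_standardized hn hσ hindep hlaw) fun ω => ?_
  rw [hZ ω, ← capabilityIndex_eq_ratio hn0 hσ hN, sumSqDev_eq_mul hn0 hσ.ne' (μ := μ),
    ← neg_sub (sampleMean _) T]
  have hmean : sampleMean (fun i => X i ω) - T =
      σ * (√n * sampleMean (fun i => (X i ω - μ) / σ) + √n * (μ - T) / σ) / √n := by
    rw [sampleMean_eq_add_mul hn0 hσ.ne' (μ := μ)]
    field_simp
    ring
  rw [hmean]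

end Capability

open Capability

theorem mainTheorem6 {Ω : Type*} [MeasurableSpace Ω] (P : Measure Ω) [IsProbabilityMeasure P]
    (n : ℕ) (hn : 2 ≤ n) (μ σ T k : ℝ) (hσ : 0 < σ) (hk : 1 < k)
    (X : Fin n → Ω → ℝ) (hindep : iIndepFun X P)
    (hlaw : ∀ i, HasLaw (X i) (gaussianReal μ (Real.toNNReal (σ ^ 2))) P)
    (δ : ℝ) (hδ : δ = Real.sqrt n * (μ - T) / σ) :
    -- upper tolerance
    (∀ U B : ℝ, T < U → B = Real.sqrt n * (U - T) / σ →
      HasSplitDensity (fun ω => cpkuHat U T k (fun i => X i ω)) P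
        (J₁ (chiSqPDF ((n : ℝ) - 1)) (upperShiftPDF k δ) B) 1 ∧
      HasSplitDensity (fun ω => cpkuHat U T k (fun i => X i ω)) P
        (J₁' (chiSqPDF ((n : ℝ) - 1)) (upperShiftPDF k δ) B) (B ^ 2) ∧
      (∀ ω, cpkuHat' U T k (fun i => X i ω) =
        Real.sqrt (((n : ℝ) - 1) / n) * cpkuHat U T k (fun i => X i ω)) ∧
      HasSplitDensity (fun ω => cpkuHat' U T k (fun i => X i ω)) P
        (L₁ n (chiSqPDF ((n : ℝ) - 1)) (upperShiftPDF k δ) B) 1) ∧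
    -- lower tolerance
    (∀ L B : ℝ, L < T → B = Real.sqrt n * (T - L) / σ →
      HasSplitDensity (fun ω => cpklHat L T k (fun i => X i ω)) P
        (J₁ (chiSqPDF ((n : ℝ) - 1)) (lowerShiftPDF k δ) B) 1 ∧
      HasSplitDensity (fun ω => cpklHat L T k (fun i => X i ω)) P
        (J₁' (chiSqPDF ((n : ℝ) - 1)) (lowerShiftPDF k δ) B) (B ^ 2) ∧
      (∀ ω, cpklHat' L T k (fun i => X i ω) =
        Real.sqrt (((n : ℝ) - 1) / n) * cpklHat L T k (fun i => X i ω)) ∧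
      HasSplitDensity (fun ω => cpklHat' L T k (fun i => X i ω)) P
        (L₁ n (chiSqPDF ((n : ℝ) - 1)) (lowerShiftPDF k δ) B) 1) := by
  subst hδ
  have hn' : (2 : ℝ) ≤ n := by exact_mod_cast hn
  have hn0 : (0 : ℝ) < n := by linarith
  have hn1 : (0 : ℝ) < n - 1 := by linarith
  have hk0 : 0 < k := by linarith
  have hsn : 0 < √(n : ℝ) := Real.sqrt_pos.2 hn0
  constructor
  · rintro U B hU rfl
    have hD : 0 < U - T := sub_pos.2 hU
    have hB : 0 < √n * (U - T) / σ := by positivity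
    have hJ := hasSplitDensity_capabilityIndex (T := T) hn hσ one_pos hk0 hD hindep hlaw
      (Z := fun ω => cpkuHat U T k (fun i => X i ω)) hn0 fun ω => by
        simp [cpkuHat, cpuHat, upperShift, sampleVar]
    have hL := hasSplitDensity_capabilityIndex (T := T) hn hσ one_pos hk0 hD hindep hlaw
      (Z := fun ω => cpkuHat' U T k (fun i => X i ω)) hn1 fun ω => by
        simp [cpkuHat', cpuHat', upperShift, sampleVar']
    rw [div_self hn0.ne'] at hJ
    rw [upperShiftPDF_eq, J₁'_eq_ratioIntegrand]
    exact ⟨hJ.comp_mul_left (by positivity) (J₁_eq_ratioIntegrand _ _ hB.le), hJ,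
      fun ω => sqrt_mul_capabilityIndex hn _ _ _,
      hL.comp_mul_left (by positivity) (L₁_eq_ratioIntegrand n _ _ hB.le)⟩
  · rintro L B hL rfl
    have hD : 0 < T - L := sub_pos.2 hL
    have hB : 0 < √n * (T - L) / σ := by positivity
    have hJ := hasSplitDensity_capabilityIndex (T := T) hn hσ hk0 one_pos hD hindep hlaw
      (Z := fun ω => cpklHat L T k (fun i => X i ω)) hn0 fun ω => by
        simp [cpklHat, cplHat, lowerShift, sampleVar]
    have hL := hasSplitDensity_capabilityIndex (T := T) hn hσ hk0 one_pos hD hindep hlaw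
      (Z := fun ω => cpklHat' L T k (fun i => X i ω)) hn1 fun ω => by
        simp [cpklHat', cplHat', lowerShift, sampleVar']
    rw [div_self hn0.ne'] at hJ
    rw [lowerShiftPDF_eq, J₁'_eq_ratioIntegrand]
    exact ⟨hJ.comp_mul_left (by positivity) (J₁_eq_ratioIntegrand _ _ hB.le), hJ,
      fun ω => sqrt_mul_capabilityIndex hn _ _ _,
      hL.comp_mul_left (by positivity) (L₁_eq_ratioIntegrand n _ _ hB.le)⟩
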